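/- For $n\ge 2$ let $\Gamma_n$ be the set of all $(\alpha,\beta)$ with $\alpha,\beta>0$ and $\frac n2\frac{\pi}{\sqrt\alpha}+\frac n2\frac{\pi}{\sqrt\beta}=\pi$ if $n$ is even, respectively $\frac{n+1}2\frac{\pi}{\sqrt\alpha}+\frac{n-1}2\frac{\pi}{\sqrt\beta}=\pi$ if $n$ is odd. For $n\ge2$ and $(\alpha,\beta)\in\Gamma_n$ let $f^n_{\alpha,\beta}$ be the normalized Fučík eigenfunction, that is, the solution $u\in C^2[0,\pi]$ of $$-u''=\alpha u^+-\beta u^-\ \text{ in }(0,\pi),\qquad u(0)=u(\pi)=0,$$ with $u'(0)>0$ and $\sup_{[0,\pi]}|u|=1$, where $u^{\pm}=\max(\pm u,0)$; and let $f^1_{1,1}(x)=\sin x$. A Fučík system $F_{\alpha,\beta}$ is a sequence $\{f^n_{\alpha(n),\beta(n)}\}_{n\ge1}$ with $\alpha,\beta\colon\mathbb N\to\mathbb R$, $\alpha(1)=\beta(1)=1$ and $(\alpha(n),\beta(n))\in\Gamma_n$ for every $n\ge2$. A sequence $\{\psi_n\}_{n\ge1}$ in $L^2(0,\pi)$ is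 a Riesz basis if its linear span is dense and there are constants $c,C>0$ such that $$c\sum_{n=1}^N|a_n|^2\le\Big\|\sum_{n=1}^N a_n\psi_n\Big\|^2\le C\sum_{n=1}^N|a_n|^2$$ for all $N\in\mathbb N$ and all scalars $a_1,\dots,a_N$. **Theorem.** Let $F_{\alpha,\beta}$ be a Fučík system with $\alpha(n)=\beta(n)=n^2$ for every odd $n$. If $$\sum_{n=2}^\infty\left(\frac{\max(\sqrt{\alpha(n)},\sqrt{\beta(n)})}{n}-1\right)^2<\infty,$$ then $F_{\alpha,\beta}$ is a Riesz basis of $L^2(0,\pi)$ (over the real as well as the complex scalars). -/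

import Mathlib

open MeasureTheory

/-- The curve `Γ_n` (for `n ≥ 2`) of the Fučík spectrum of the Dirichlet Laplacian on `(0, π)`,
whose eigenfunctions have `n` bumps and start with a positive one. The positivity of `α` and `β`
is implicit in the occurrence of `π / √α` and `π / √β`, the lengths of the bumps. -/
def fucikCurve (n : ℕ) : Set (ℝ × ℝ) :=
  {p | 0 < p.1 ∧ 0 < p.2 ∧
    if Even n then
      (n : ℝ) / 2 * (Real.pi / √p.1) + (n : ℝ) / 2 * (Real.pi / √p.2) = Real.pi
    else
      ((n : ℝ) + 1) / 2 * (Real.pi / √p.1) + ((n : ℝ) - 1) / 2 * (Real.pi / √p.2) = Real.pi}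

/-- `u` is a classical solution, twice continuously differentiable on `[0, π]`, of
`-u'' = α u⁺ - β u⁻` in `(0, π)`, `u(0) = u(π) = 0`. -/
structure IsFucikSolution (α β : ℝ) (u : ℝ → ℝ) : Prop where
  contDiffOn : ContDiffOn ℝ 2 u (Set.Icc 0 Real.pi)
  equation : ∀ x ∈ Set.Ioo 0 Real.pi,
    -deriv (deriv u) x = α * max (u x) 0 - β * max (-u x) 0
  left_zero : u 0 = 0
  right_zero : u Real.pi = 0

/-- `u` is, on `[0, π]`, the normalized Fučík eigenfunction `f^n_{α,β}`. For `n ≥ 2` and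
`(α, β) ∈ Γ_n` it is the solution with positive (one-sided) derivative at `0` and sup-norm `1`;
for `n = 1` and `(α, β)` in the trivial part of the spectrum it is `sin`. -/
def IsNormalizedFucikEigenfunction (n : ℕ) (α β : ℝ) (u : ℝ → ℝ) : Prop :=
  (n = 1 ∧ (α = 1 ∨ β = 1) ∧ ∀ x ∈ Set.Icc 0 Real.pi, u x = Real.sin x) ∨
  (2 ≤ n ∧ (α, β) ∈ fucikCurve n ∧ IsFucikSolution α β u ∧
    0 < derivWithin u (Set.Icc 0 Real.pi) 0 ∧
    IsLUB ((fun x => |u x|) '' Set.Icc 0 Real.pi) 1)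

/-- `F` is the Fučík system `F_{α,β}`, that is, `F n` is (on `[0, π]`) the normalized Fučík
eigenfunction `f^n_{α(n),β(n)}` for `n = 1, 2, 3, …`. Values at `n = 0` are irrelevant. -/
structure IsFucikSystem (α β : ℕ → ℝ) (F : ℕ → ℝ → ℝ) : Prop where
  alpha_one : α 1 = 1
  beta_one : β 1 = 1
  mem_curve : ∀ n, 2 ≤ n → (α n, β n) ∈ fucikCurve n
  eigenfunction : ∀ n, 1 ≤ n → IsNormalizedFucikEigenfunction n (α n) (β n) (F n)

/-- A Riesz basis: a complete sequence (dense linear span) such that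
`c ∑ |aₙ|² ≤ ‖∑ aₙ ψₙ‖² ≤ C ∑ |aₙ|²` for all finite families of scalars, with some `c, C > 0`. -/
def IsRieszBasis (𝕜 : Type*) [RCLike 𝕜] {H : Type*} [NormedAddCommGroup H] [NormedSpace 𝕜 H]
    (ψ : ℕ → H) : Prop :=
  (Submodule.span 𝕜 (Set.range ψ)).topologicalClosure = ⊤ ∧
  ∃ c C : ℝ, 0 < c ∧ 0 < C ∧ ∀ (N : ℕ) (a : ℕ → 𝕜),
    c * ∑ n ∈ Finset.range N, ‖a n‖ ^ 2 ≤ ‖∑ n ∈ Finset.range N, a n • ψ n‖ ^ 2 ∧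
    ‖∑ n ∈ Finset.range N, a n • ψ n‖ ^ 2 ≤ C * ∑ n ∈ Finset.range N, ‖a n‖ ^ 2

/-- The sequence of real functions `f 1, f 2, f 3, …` lies in `L²((0, π); 𝕜)` (Lebesgue measure)
and is a Riesz basis of this space. -/
def IsRieszBasisL2 (𝕜 : Type*) [RCLike 𝕜] (f : ℕ → ℝ → ℝ) : Prop :=
  ∃ h : ∀ n : ℕ, MemLp (fun x => ((f (n + 1) x : ℝ) : 𝕜)) 2
      (volume.restrict (Set.Ioo 0 Real.pi)),
    IsRieszBasis 𝕜 (fun n => (h n).toLp (fun x => ((f (n + 1) x : ℝ) : 𝕜)))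

/-! Compare ψ_n = √(2/π) f^n with the orthonormal sines e_n = √(2/π) sin nx. For even n, |f^n − sin
nx| ≤ (2 + π)(max(√α, √β)/n − 1); for odd n the difference vanishes. So the system is quadratically
close to the basis, K = Σ ⟨e_n, ·⟩(ψ_n − e_n) is a norm limit of finite-rank operators, hence
compact, and 1 + K maps e_n to ψ_n. By the Fredholm alternative only the injectivity of 1 + K is
missing; the sum need not be small.

Injectivity comes from the arithmetic of the periods. The periodic extension of f^{2m} has period
π/m, so among the even frequencies 2i it meets only those with m ∣ i, in particular i ≥ m
(`integral_periodic_mul_sin_eq_zero`). Its odd frequencies are uncontrolled, but f^n is exactly sin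
nx for odd n. Ranking all even indices before all odd ones therefore makes the matrix ⟨e_n, ψ_m⟩
triangular for a well-founded order. Its diagonal does not vanish, because each bump contributes
positively to ∫ f^n sin nx (`integral_fucikWave_mul_sin_pos`).
`HilbertBasis.isRieszBasis_of_triangular` concludes.

The explicit shape of f^n, on which these estimates rest, follows from uniqueness for the initial
value problem, `IsFucikSolution.eq_of_initial_eq`. -/

/-! ### Riesz bases from compact perturbations of a Hilbert basis -/

section RieszBasis

variable {𝕜 H : Type*} [RCLike 𝕜] [NormedAddCommGroup H] [InnerProductSpace 𝕜 H]

/-- Cauchy–Schwarz and Bessel: a finite sum of rank one operators `x ↦ ⟪e n, x⟫ g n`, with `e`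
orthonormal, has operator norm at most the `ℓ²`-norm of `g`. -/
theorem norm_sum_smulRight_innerSL_le {ι : Type*} {e : ι → H} (he : Orthonormal 𝕜 e)
    (g : ι → H) (s : Finset ι) :
    ‖∑ n ∈ s, (innerSL 𝕜 (e n)).smulRight (g n)‖ ≤ √(∑ n ∈ s, ‖g n‖ ^ 2) := by
  refine ContinuousLinearMap.opNorm_le_bound _ (Real.sqrt_nonneg _) fun x => ?_
  have happ : (∑ n ∈ s, (innerSL 𝕜 (e n)).smulRight (g n)) x = ∑ n ∈ s, inner 𝕜 (e n) x • g n := by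
    simp
  rw [happ]
  calc ‖∑ n ∈ s, inner 𝕜 (e n) x • g n‖
      ≤ ∑ n ∈ s, ‖g n‖ * ‖inner 𝕜 (e n) x‖ := by
        refine (norm_sum_le _ _).trans (le_of_eq (Finset.sum_congr rfl fun n _ => ?_))
        rw [norm_smul, mul_comm]
    _ ≤ √(∑ n ∈ s, ‖g n‖ ^ 2) * √(∑ n ∈ s, ‖inner 𝕜 (e n) x‖ ^ 2) :=
        Real.sum_mul_le_sqrt_mul_sqrt _ _ _
    _ ≤ √(∑ n ∈ s, ‖g n‖ ^ 2) * ‖x‖ := by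
        gcongr
        exact Real.sqrt_le_iff.2 ⟨norm_nonneg _, he.sum_inner_products_le x⟩

theorem summable_smulRight_innerSL [CompleteSpace H] {ι : Type*} {e : ι → H}
    (he : Orthonormal 𝕜 e) {g : ι → H} (hg : Summable fun n => ‖g n‖ ^ 2) :
    Summable fun n => (innerSL 𝕜 (e n)).smulRight (g n) := by
  rw [summable_iff_vanishing_norm]
  intro ε hε
  obtain ⟨s, hs⟩ := summable_iff_vanishing_norm.1 hg (ε ^ 2) (by positivity)
  refine ⟨s, fun t ht => (norm_sum_smulRight_innerSL_le he g t).trans_lt ?_⟩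
  rw [Real.sqrt_lt' hε]
  exact (le_abs_self _).trans_lt (hs t ht)

theorem isCompactOperator_smulRight (f : StrongDual 𝕜 H) (g : H) :
    IsCompactOperator (f.smulRight g) := by
  have h : IsCompactOperator (f : H → 𝕜) := 
    isCompactOperator_of_locallyCompactSpace_dom f
  exact h.clm_comp (ContinuousLinearMap.toSpanSingleton 𝕜 g)

/-- Square-summability gives convergence in operator norm, and a norm limit of finite-rank operators
is compact. -/
theorem isCompactOperator_tsum_smulRight_innerSL [CompleteSpace H] {ι : Type*} {e : ι → H}
    (he : Orthonormal 𝕜 e) {g : ι → H} (hg : Summable fun n => ‖g n‖ ^ 2) :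
    IsCompactOperator (∑' n, (innerSL 𝕜 (e n)).smulRight (g n) : H →L[𝕜] H) := by
  refine isCompactOperator_of_tendsto (summable_smulRight_innerSL he hg).hasSum
    (Filter.Eventually.of_forall fun s => ?_)
  induction s using Finset.cons_induction with
  | empty => simpa using isCompactOperator_zero
  | cons a s ha ih =>
    rw [Finset.sum_cons]
    exact (isCompactOperator_smulRight _ _).add ih

/-- The image of a Hilbert basis under a bounded invertible operator is a Riesz basis. -/
theorem HilbertBasis.isRieszBasis_map (e : HilbertBasis ℕ 𝕜 H) (T : H ≃L[𝕜] H) :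
    IsRieszBasis 𝕜 fun n => T (e n) := by
  have hnorm (N : ℕ) (a : ℕ → 𝕜) :
      ‖∑ n ∈ Finset.range N, a n • e n‖ ^ 2 = ∑ n ∈ Finset.range N, ‖a n‖ ^ 2 := by
    rw [← inner_self_eq_norm_sq (𝕜 := 𝕜), e.orthonormal.inner_sum, map_sum]
    refine Finset.sum_congr rfl fun n _ => ?_
    rw [RCLike.conj_mul, ← RCLike.ofReal_pow, RCLike.ofReal_re]
  have hmap (N : ℕ) (a : ℕ → 𝕜) :
      ∑ n ∈ Finset.range N, a n • T (e n) = T (∑ n ∈ Finset.range N, a n • e n) := by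
    simp [map_sum]
  -- Adding 1 makes both constants positive without discussing whether the operator norms vanish.
  refine ⟨?_, (‖(T.symm : H →L[𝕜] H)‖ ^ 2 + 1)⁻¹, ‖(T : H →L[𝕜] H)‖ ^ 2 + 1, by positivity,
    by positivity, fun N a => ?_⟩
  · have h := T.surjective.denseRange.topologicalClosure_map_submodule (f := (T : H →L[𝕜] H))
      e.dense_span
    rw [Submodule.map_span, ← Set.range_comp] at h
    exact h
  · rw [hmap, ← hnorm]
    set x := ∑ n ∈ Finset.range N, a n • e n
    constructor
    · rw [inv_mul_le_iff₀ (by positivity)]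
      have h := (T.symm : H →L[𝕜] H).le_opNorm (T x)
      simp only [ContinuousLinearEquiv.coe_coe, ContinuousLinearEquiv.symm_apply_apply] at h
      calc ‖x‖ ^ 2 ≤ (‖(T.symm : H →L[𝕜] H)‖ * ‖T x‖) ^ 2 := by gcongr
        _ ≤ _ := by nlinarith [sq_nonneg ‖T x‖]
    · have h := (T : H →L[𝕜] H).le_opNorm x
      simp only [ContinuousLinearEquiv.coe_coe] at h
      calc ‖T x‖ ^ 2 ≤ (‖(T : H →L[𝕜] H)‖ * ‖x‖) ^ 2 := by gcongr
        _ ≤ _ := by nlinarith [sq_nonneg ‖x‖]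

/-- A sequence that is quadratically close to a Hilbert basis `e` and triangular with respect to
`e`, for some well-founded ranking of the indices, is a Riesz basis. -/
theorem HilbertBasis.isRieszBasis_of_triangular [CompleteSpace H] (e : HilbertBasis ℕ 𝕜 H)
    {ψ : ℕ → H} (hsum : Summable fun n => ‖ψ n - e n‖ ^ 2) {ι : Type*} [Preorder ι]
    [WellFoundedLT ι] (rank : ℕ → ι) (hdiag : ∀ n, inner 𝕜 (e n) (ψ n) ≠ 0)
    (htri : ∀ n m, m ≠ n → ¬ rank m < rank n → inner 𝕜 (e n) (ψ m) = 0) :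
    IsRieszBasis 𝕜 ψ := by
  set K : H →L[𝕜] H := ∑' n, (innerSL 𝕜 (e n)).smulRight (ψ n - e n) with hK
  have hs := summable_smulRight_innerSL e.orthonormal hsum
  have hKc : IsCompactOperator K := isCompactOperator_tsum_smulRight_innerSL e.orthonormal hsum
  have hKx (x : H) : HasSum (fun n => inner 𝕜 (e n) x • (ψ n - e n)) (K x) := by
    simpa using (ContinuousLinearMap.apply 𝕜 H x).hasSum hs.hasSum
  have hTx (x : H) : HasSum (fun n => inner 𝕜 (e n) x • ψ n) (x + K x) := by
    have h := (e.hasSum_repr x).add (hKx x)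
    simp only [HilbertBasis.repr_apply_apply, ← smul_add, add_sub_cancel] at h
    exact h
  have hKe (m : ℕ) : e m + K (e m) = ψ m := by
    refine (hTx (e m)).unique ?_
    convert hasSum_ite_eq m (ψ m) using 2 with n
    rw [orthonormal_iff_ite.1 e.orthonormal n m]
    split_ifs with h <;> simp [h]
  -- Pairing Σ ⟨e m, x⟩ ψ m = 0 with `e n` leaves only the term m = n: terms of smaller rank vanish
  -- by induction, all others by `htri`. Then `hdiag` kills ⟨e n, x⟩.
  have hinj (x : H) (hx : x + K x = 0) : x = 0 := by
    have hcoef : ∀ n, inner 𝕜 (e n) x = (0 : 𝕜) := by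
      intro n
      induction n using (InvImage.wf rank wellFounded_lt).induction with
      | _ n ih =>
      have h := (innerSL 𝕜 (e n)).hasSum (hTx x)
      rw [hx, map_zero] at h
      have h2 := h.unique (hasSum_single n fun m hm => ?_)
      · simpa [inner_smul_right, hdiag n] using h2.symm
      · simp only [innerSL_apply_apply, inner_smul_right]
        by_cases hr : rank m < rank n
        · rw [ih m hr, zero_mul]
        · rw [htri n m hm hr, mul_zero]
    have h := e.hasSum_repr x
    simp only [HilbertBasis.repr_apply_apply, hcoef, zero_smul] at h
    exact h.unique hasSum_zero
  have hunit : IsUnit (1 + K) := by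
    -- Fredholm alternative at −1: either −1 is an eigenvalue of K, excluded by `hinj`, or −1 − K is
    -- invertible.
    rcases hKc.hasEigenvalue_or_mem_resolventSet (μ := (-1 : 𝕜)) (by simp) with h | h
    · obtain ⟨x, hx⟩ := h.exists_hasEigenvector
      refine absurd (hinj x ?_) hx.2
      have := hx.apply_eq_smul
      simp only [ContinuousLinearMap.coe_coe, neg_smul, one_smul] at this
      rw [this, add_neg_cancel]
    · rw [spectrum.mem_resolventSet_iff] at h
      have h2 : (1 + K) = -(algebraMap 𝕜 (H →L[𝕜] H) (-1) - K) := by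
        rw [map_neg, map_one]; abel
      rw [h2]
      exact h.neg
  convert e.isRieszBasis_map (ContinuousLinearEquiv.ofUnit hunit.unit) using 2 with n
  rw [← hKe n]
  rfl

/-- Needed because the eigenfunctions have sup-norm 1, while the orthonormal sines carry the factor
√(2/π). -/
theorem IsRieszBasis.of_smul {ψ : ℕ → H} {c : 𝕜} (hc : c ≠ 0)
    (h : IsRieszBasis 𝕜 fun n => c • ψ n) : IsRieszBasis 𝕜 ψ := by
  obtain ⟨h1, A, B, hA, hB, h2⟩ := h
  have hc' : 0 < ‖c‖ ^ 2 := by have := norm_pos_iff.2 hc; positivity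
  refine ⟨?_, A / ‖c‖ ^ 2, B / ‖c‖ ^ 2, by positivity, by positivity, fun N a => ?_⟩
  · rw [eq_top_iff, ← h1]
    refine Submodule.topologicalClosure_mono (Submodule.span_le.2 ?_)
    rintro _ ⟨n, rfl⟩
    exact Submodule.smul_mem _ _ (Submodule.subset_span ⟨n, rfl⟩)
  · have h := h2 N a
    have h3 : ∑ n ∈ Finset.range N, a n • c • ψ n = c • ∑ n ∈ Finset.range N, a n • ψ n := by
      rw [Finset.smul_sum]
      exact Finset.sum_congr rfl fun n _ => smul_comm _ _ _
    rw [h3, norm_smul, mul_pow] at h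
    rw [div_mul_eq_mul_div, div_mul_eq_mul_div, div_le_iff₀ hc', le_div_iff₀ hc', mul_comm _ (‖c‖ ^ 2)]
    exact h

end RieszBasis

/-! ### The sine basis of L²(0, π) -/

section SineBasis

open Set

theorem integral_sin_mul_mul_sin_mul {a c : ℝ} (h : a ^ 2 ≠ c ^ 2) (T : ℝ) :
    ∫ t in 0..T, Real.sin (a * t) * Real.sin (c * t) =
      (a * Real.cos (a * T) * Real.sin (c * T) - c * Real.sin (a * T) * Real.cos (c * T)) /
        (c ^ 2 - a ^ 2) := by
  have hne : c ^ 2 - a ^ 2 ≠ 0 := sub_ne_zero.2 h.symm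
  have hderiv (t : ℝ) : HasDerivAt
      (fun t => (a * Real.cos (a * t) * Real.sin (c * t) - c * Real.sin (a * t) * Real.cos (c * t)) /
        (c ^ 2 - a ^ 2)) (Real.sin (a * t) * Real.sin (c * t)) t := by
    have ha := (hasDerivAt_id t).const_mul a
    have hc := (hasDerivAt_id t).const_mul c
    refine ((((ha.cos.const_mul a).mul hc.sin).sub
      ((ha.sin.const_mul c).mul hc.cos)).div_const (c ^ 2 - a ^ 2)).congr_deriv ?_
    rw [div_eq_iff hne]
    simp only [id]
    ring
  rw [intervalIntegral.integral_eq_sub_of_hasDerivAt (fun t _ => hderiv t)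
    (Continuous.intervalIntegrable (by fun_prop) _ _)]
  simp

theorem integral_sin_mul_sq {a : ℝ} (ha : a ≠ 0) (T : ℝ) :
    ∫ t in 0..T, Real.sin (a * t) * Real.sin (a * t) =
      T / 2 - Real.sin (a * T) * Real.cos (a * T) / (2 * a) := by
  have hderiv (t : ℝ) : HasDerivAt
      (fun t => t / 2 - Real.sin (a * t) * Real.cos (a * t) / (2 * a))
      (Real.sin (a * t) * Real.sin (a * t)) t := by
    have h := (hasDerivAt_id t).const_mul a
    refine (((hasDerivAt_id t).div_const 2).sub
      ((h.sin.mul h.cos).div_const (2 * a))).congr_deriv ?_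
    simp only [id]
    field_simp
    linear_combination (-1 : ℝ) * Real.sin_sq_add_cos_sq (a * t)
  rw [intervalIntegral.integral_eq_sub_of_hasDerivAt (fun t _ => hderiv t)
    (Continuous.intervalIntegrable (by fun_prop) _ _)]
  simp

theorem integral_sin_nat_mul_sin_nat {m n : ℕ} (hn : n ≠ 0) :
    ∫ t in 0..Real.pi, Real.sin (m * t) * Real.sin (n * t) = if m = n then Real.pi / 2 else 0 := by
  split_ifs with h
  · rw [h, integral_sin_mul_sq (by exact_mod_cast hn), Real.sin_nat_mul_pi]
    simp
  · rw [integral_sin_mul_mul_sin_mul, Real.sin_nat_mul_pi, Real.sin_nat_mul_pi]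
    · simp
    · exact_mod_cast fun h' => h (Nat.pow_left_injective (by norm_num : (2 : ℕ) ≠ 0) h')

theorem setIntegral_Ioo_zero_pi {E : Type*} [NormedAddCommGroup E] [NormedSpace ℝ E] (f : ℝ → E) :
    ∫ x in Ioo 0 Real.pi, f x = ∫ x in 0..Real.pi, f x := by
  rw [intervalIntegral.integral_of_le Real.pi_pos.le, integral_Ioc_eq_integral_Ioo]

/-- The sines `sin x, sin 2x, …` are complete in `L²(0, π)`. -/
theorem ae_eq_zero_of_integral_sin_mul_eq_zero {g : ℝ → ℝ}
    (hg : MemLp g 2 (volume.restrict (Ioo 0 Real.pi)))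
    (h : ∀ n : ℕ, ∫ x in Ioo 0 Real.pi, Real.sin ((n + 1 : ℕ) * x) * g x = 0) :
    g =ᵐ[volume.restrict (Ioo 0 Real.pi)] 0 := by
  have hpi : -Real.pi < Real.pi := by linarith [Real.pi_pos]
  set k : ℝ → ℂ := (Ioo 0 Real.pi).indicator fun x => (g x : ℂ) with hk
  have hkL : MemLp k 2 volume := (memLp_indicator_iff_restrict measurableSet_Ioo).2 hg.ofReal
  have hkL' : MemLp (fun x => k (-x)) 2 volume :=
    hkL.comp_measurePreserving (Measure.measurePreserving_neg volume)
  -- G is the odd extension of g to (−π, π]. Its Fourier coefficients are multiples of the sine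
  -- integrals of g, so they all vanish, and Parseval gives G = 0.
  set G : ℝ → ℂ := fun x => k x - k (-x) with hG
  have hGL : MemLp G 2 (volume.restrict (Ioc (-Real.pi) Real.pi)) := (hkL.sub hkL').restrict _
  have hki : IntervalIntegrable k volume (-Real.pi) Real.pi := by
    rw [intervalIntegrable_iff, uIoc_of_le hpi.le]
    exact (hkL.restrict _).integrable one_le_two
  have hki' : IntervalIntegrable (fun x => k (-x)) volume (-Real.pi) Real.pi := by
    rw [intervalIntegrable_iff, uIoc_of_le hpi.le]
    exact (hkL'.restrict _).integrable one_le_two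
  have hsin (n : ℤ) : ∫ x in Ioo 0 Real.pi, Real.sin (n * x) * g x = 0 := by
    obtain ⟨j, rfl | rfl⟩ := n.eq_nat_or_neg
    · rcases j with _ | j
      · simp
      · exact_mod_cast h j
    · rcases j with _ | j
      · simp
      · have h' := h j
        simp only [Int.cast_neg, Int.cast_natCast, neg_mul, Real.sin_neg]
        rw [integral_neg, h', neg_zero]
  have hexp (c : ℝ) : ContinuousOn (fun x : ℝ => Complex.exp (-(c * x) * Complex.I))
      (uIcc (-Real.pi) Real.pi) := by fun_prop
  have hcoef (n : ℤ) : fourierCoeffOn hpi G n = 0 := by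
    rw [fourierCoeffOn_eq_integral]
    refine smul_eq_zero_of_right _ ?_
    have e1 (x : ℝ) : fourier (-n) (x : AddCircle (Real.pi - -Real.pi)) =
        Complex.exp (-((n : ℝ) * x) * Complex.I) := by
      rw [fourier_coe_apply]
      congr 1
      have : (Real.pi : ℂ) ≠ 0 := by exact_mod_cast Real.pi_ne_zero
      push_cast
      field_simp
      ring
    simp only [e1, smul_eq_mul, hG, mul_sub]
    rw [intervalIntegral.integral_sub (hki.continuousOn_mul (hexp n))
      (hki'.continuousOn_mul (hexp n))]
    have e2 : ∫ x in -Real.pi..Real.pi, Complex.exp (-((n : ℝ) * x) * Complex.I) * k (-x) =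
        ∫ x in -Real.pi..Real.pi, Complex.exp (((n : ℝ) * x) * Complex.I) * k x := by
      have := intervalIntegral.integral_comp_neg (a := -Real.pi) (b := Real.pi)
        (fun x : ℝ => Complex.exp (((n : ℝ) * x) * Complex.I) * k x)
      rw [neg_neg] at this
      rw [← this]
      congr 1
      ext x
      push_cast
      ring_nf
    have hexp' : ContinuousOn (fun x : ℝ => Complex.exp (((n : ℝ) * x) * Complex.I))
      (uIcc (-Real.pi) Real.pi) := by fun_prop
    rw [e2, ← intervalIntegral.integral_sub (hki.continuousOn_mul (hexp n))
      (hki.continuousOn_mul hexp')]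
    have e3 (x : ℝ) : Complex.exp (-((n : ℝ) * x) * Complex.I) * k x -
        Complex.exp (((n : ℝ) * x) * Complex.I) * k x =
        (Ioo 0 Real.pi).indicator
          (fun x => (-2 * Complex.I) * ((Real.sin (n * x) * g x : ℝ) : ℂ)) x := by
      rw [← sub_mul, Complex.exp_mul_I, Complex.exp_mul_I, Complex.cos_neg, Complex.sin_neg, hk]
      by_cases hx : x ∈ Ioo 0 Real.pi
      · rw [indicator_of_mem hx, indicator_of_mem hx]
        push_cast
        ring
      · rw [indicator_of_notMem hx, indicator_of_notMem hx, mul_zero]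
    simp only [e3]
    rw [intervalIntegral.integral_of_le hpi.le, setIntegral_indicator measurableSet_Ioo,
      inter_eq_right.2 (Ioo_subset_Ioc_self.trans (Ioc_subset_Ioc_left (by linarith))),
      integral_const_mul, integral_complex_ofReal, hsin]
    simp
  have hpars := hasSum_sq_fourierCoeffOn hpi hGL
  simp only [hcoef, norm_zero, ne_eq, OfNat.ofNat_ne_zero, not_false_eq_true, zero_pow] at hpars
  have hzero : ∫ x in -Real.pi..Real.pi, ‖G x‖ ^ 2 = 0 := by
    have := hpars.unique hasSum_zero
    simpa [Real.pi_ne_zero] using this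
  rw [intervalIntegral.integral_of_le hpi.le, integral_eq_zero_iff_of_nonneg
    (fun x => by positivity) ((memLp_two_iff_integrable_sq_norm hGL.1).1 hGL)] at hzero
  have hz := ae_restrict_of_ae_restrict_of_subset
    (Ioo_subset_Ioc_self.trans (Ioc_subset_Ioc_left (by linarith [Real.pi_pos])) :
      Ioo 0 Real.pi ⊆ Ioc (-Real.pi) Real.pi) hzero
  filter_upwards [hz, ae_restrict_mem measurableSet_Ioo] with x hx hmem
  have hneg : -x ∉ Ioo 0 Real.pi := fun h => by linarith [h.1, hmem.1]
  simpa [hG, hk, indicator_of_mem hmem, indicator_of_notMem hneg] using hx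

variable (𝕜 : Type*) [RCLike 𝕜]

/-- A real square-integrable function on `(0, π)` as an element of `L²((0, π); 𝕜)`. -/
noncomputable def toL2 {f : ℝ → ℝ} (hf : MemLp f 2 (volume.restrict (Ioo 0 Real.pi))) :
    Lp 𝕜 2 (volume.restrict (Ioo 0 Real.pi)) :=
  (hf.ofReal (K := 𝕜)).toLp

variable {𝕜}

theorem inner_toL2 {f : ℝ → ℝ} (hf : MemLp f 2 (volume.restrict (Ioo 0 Real.pi)))
    (g : Lp 𝕜 2 (volume.restrict (Ioo 0 Real.pi))) :
    inner 𝕜 (toL2 𝕜 hf) g = ∫ x in Ioo 0 Real.pi, (f x : 𝕜) * g x := by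
  rw [L2.inner_def]
  refine integral_congr_ae ?_
  filter_upwards [(hf.ofReal (K := 𝕜)).coeFn_toLp] with x hx
  rw [toL2, hx, RCLike.inner_apply, RCLike.conj_ofReal, mul_comm]

theorem inner_toL2_toL2 {f g : ℝ → ℝ} (hf : MemLp f 2 (volume.restrict (Ioo 0 Real.pi)))
    (hg : MemLp g 2 (volume.restrict (Ioo 0 Real.pi))) :
    inner 𝕜 (toL2 𝕜 hf) (toL2 𝕜 hg) = ((∫ x in 0..Real.pi, f x * g x : ℝ) : 𝕜) := by
  rw [inner_toL2, ← setIntegral_Ioo_zero_pi, ← integral_ofReal]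
  refine integral_congr_ae ?_
  filter_upwards [(hg.ofReal (K := 𝕜)).coeFn_toLp] with x hx
  rw [toL2, hx, RCLike.ofReal_mul]

theorem norm_toL2_sub_toL2_sq_le {f g : ℝ → ℝ}
    (hf : MemLp f 2 (volume.restrict (Ioo 0 Real.pi)))
    (hg : MemLp g 2 (volume.restrict (Ioo 0 Real.pi))) {C : ℝ} (hC : 0 ≤ C)
    (h : ∀ x ∈ Ioo 0 Real.pi, |f x - g x| ≤ C) :
    ‖toL2 𝕜 hf - toL2 𝕜 hg‖ ^ 2 ≤ Real.pi * C ^ 2 := by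
  have hb : ‖toL2 𝕜 hf - toL2 𝕜 hg‖ ≤
      measureUnivNNReal (volume.restrict (Ioo 0 Real.pi)) ^ (2 : ENNReal).toReal⁻¹ * C := by
    refine Lp.norm_le_of_ae_bound hC ?_
    filter_upwards [Lp.coeFn_sub (toL2 𝕜 hf) (toL2 𝕜 hg), (hf.ofReal (K := 𝕜)).coeFn_toLp,
      (hg.ofReal (K := 𝕜)).coeFn_toLp, ae_restrict_mem measurableSet_Ioo] with x h1 h2 h3 hx
    rw [h1, Pi.sub_apply, toL2, toL2, h2, h3, ← RCLike.ofReal_sub, RCLike.norm_ofReal]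
    exact h x hx
  have hμ : (measureUnivNNReal (volume.restrict (Ioo 0 Real.pi)) : ℝ) = Real.pi := by
    simp [measureUnivNNReal, ENNReal.coe_toNNReal_eq_toReal, Real.pi_pos.le]
  rw [hμ, ENNReal.toReal_ofNat, ← one_div, ← Real.sqrt_eq_rpow] at hb
  calc _ ≤ (√Real.pi * C) ^ 2 := by gcongr
    _ = _ := by rw [mul_pow, Real.sq_sqrt Real.pi_pos.le]

theorem memLp_smul_sin (c : ℝ) (n : ℕ) :
    MemLp (fun x => c * Real.sin (n * x)) 2 (volume.restrict (Ioo 0 Real.pi)) := by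
  refine MemLp.of_bound (by fun_prop) |c| (Filter.Eventually.of_forall fun x => ?_)
  rw [norm_mul]
  exact mul_le_of_le_one_right (abs_nonneg _) (Real.abs_sin_le_one _)

theorem orthonormal_sin :
    Orthonormal 𝕜 fun n : ℕ => toL2 𝕜 (memLp_smul_sin √(2 / Real.pi) (n + 1)) := by
  rw [orthonormal_iff_ite]
  intro m n
  rw [inner_toL2_toL2]
  have h : ∀ x : ℝ, √(2 / Real.pi) * Real.sin ((m + 1 : ℕ) * x) *
      (√(2 / Real.pi) * Real.sin ((n + 1 : ℕ) * x)) =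
      2 / Real.pi * (Real.sin ((m + 1 : ℕ) * x) * Real.sin ((n + 1 : ℕ) * x)) := by
    intro x
    have := Real.mul_self_sqrt (show 0 ≤ 2 / Real.pi by positivity)
    linear_combination this * (Real.sin ((m + 1 : ℕ) * x) * Real.sin ((n + 1 : ℕ) * x))
  simp only [h]
  rw [intervalIntegral.integral_const_mul, integral_sin_nat_mul_sin_nat n.succ_ne_zero]
  rcases eq_or_ne m n with rfl | hmn
  · have := Real.pi_ne_zero
    rw [if_pos rfl, if_pos rfl, show 2 / Real.pi * (Real.pi / 2) = 1 by field_simp]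
    simp
  · simp [hmn]

/-- The sines are real, so the real and imaginary parts of g are orthogonal to them separately; this
reduces every scalar field to real completeness. -/
theorem orthogonal_span_sin_eq_bot :
    (Submodule.span 𝕜 (range fun n : ℕ => toL2 𝕜 (memLp_smul_sin √(2 / Real.pi) (n + 1))))ᗮ
      = ⊥ := by
  have hc : √(2 / Real.pi) ≠ 0 := by positivity
  rw [Submodule.eq_bot_iff]
  intro g hg
  rw [Submodule.mem_orthogonal] at hg
  have hgL : MemLp g 2 (volume.restrict (Ioo 0 Real.pi)) := Lp.memLp g
  have hint : ∀ n : ℕ, ∫ x in Ioo 0 Real.pi, (Real.sin ((n + 1 : ℕ) * x) : 𝕜) * g x = 0 := by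
    intro n
    have h := hg _ (Submodule.subset_span ⟨n, rfl⟩)
    simp only [inner_toL2, RCLike.ofReal_mul, mul_assoc] at h
    rw [integral_const_mul] at h
    exact (mul_eq_zero.1 h).resolve_left (by exact_mod_cast hc)
  have hii (n : ℕ) : Integrable (fun x => (Real.sin ((n + 1 : ℕ) * x) : 𝕜) * g x)
      (volume.restrict (Ioo 0 Real.pi)) := by
    refine (hgL.integrable one_le_two).bdd_mul (c := 1) ?_ (Filter.Eventually.of_forall fun x => ?_)
    · exact (RCLike.continuous_ofReal.comp
        (Real.continuous_sin.comp (continuous_const.mul continuous_id))).aestronglyMeasurable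
    · rw [RCLike.norm_ofReal]; exact Real.abs_sin_le_one _
  have hre : (fun x => RCLike.re (g x)) =ᵐ[volume.restrict (Ioo 0 Real.pi)] 0 := by
    refine ae_eq_zero_of_integral_sin_mul_eq_zero hgL.re fun n => ?_
    have h := congrArg RCLike.re (hint n)
    rw [← integral_re (hii n)] at h
    simpa only [RCLike.re_ofReal_mul, map_zero] using h
  have him : (fun x => RCLike.im (g x)) =ᵐ[volume.restrict (Ioo 0 Real.pi)] 0 := by
    refine ae_eq_zero_of_integral_sin_mul_eq_zero hgL.im fun n => ?_
    have h := congrArg RCLike.im (hint n)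
    rw [← integral_im (hii n)] at h
    simpa only [RCLike.im_ofReal_mul, map_zero] using h
  rw [Lp.eq_zero_iff_ae_eq_zero]
  filter_upwards [hre, him] with x h1 h2
  exact RCLike.ext (by simpa using h1) (by simpa using h2)

variable (𝕜) in
/-- The Hilbert basis `√(2/π) sin (n + 1)x` of `L²((0, π); 𝕜)`. -/
noncomputable def sineBasis : HilbertBasis ℕ 𝕜 (Lp 𝕜 2 (volume.restrict (Ioo 0 Real.pi))) :=
  HilbertBasis.mkOfOrthogonalEqBot orthonormal_sin orthogonal_span_sin_eq_bot

theorem sineBasis_apply (n : ℕ) :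
    sineBasis 𝕜 n = toL2 𝕜 (memLp_smul_sin √(2 / Real.pi) (n + 1)) := by
  rw [sineBasis, HilbertBasis.coe_mkOfOrthogonalEqBot]

end SineBasis

/-! ### Explicit solutions of the Fučík equation -/

section FucikODE

open Set

theorem IsFucikSolution.hasDerivWithinAt {α β : ℝ} {u : ℝ → ℝ} (h : IsFucikSolution α β u)
    {x : ℝ} (hx : x ∈ Icc 0 Real.pi) :
    HasDerivWithinAt u (derivWithin u (Icc 0 Real.pi) x) (Icc 0 Real.pi) x :=
  ((h.contDiffOn.differentiableOn (by norm_num)) x hx).hasDerivWithinAt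

/-- Both sides of the equation are continuous on [0, π] and agree on the dense open interval, hence
also at the endpoints. The endpoint 0 is where the initial value problem starts. -/
theorem IsFucikSolution.hasDerivWithinAt_derivWithin {α β : ℝ} {u : ℝ → ℝ}
    (h : IsFucikSolution α β u) {x : ℝ} (hx : x ∈ Icc 0 Real.pi) :
    HasDerivWithinAt (derivWithin u (Icc 0 Real.pi)) (-(α * max (u x) 0 - β * max (-u x) 0))
      (Icc 0 Real.pi) x := by
  have hud : UniqueDiffOn ℝ (Icc 0 Real.pi) := uniqueDiffOn_Icc Real.pi_pos
  have h1 : ContDiffOn ℝ 1 (derivWithin u (Icc 0 Real.pi)) (Icc 0 Real.pi) :=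
    h.contDiffOn.derivWithin hud (by norm_num)
  have h2 : ContinuousOn (derivWithin (derivWithin u (Icc 0 Real.pi)) (Icc 0 Real.pi))
      (Icc 0 Real.pi) := h1.continuousOn_derivWithin hud le_rfl
  have hu := h.contDiffOn.continuousOn
  have h3 : ContinuousOn (fun x => -(α * max (u x) 0 - β * max (-u x) 0)) (Icc 0 Real.pi) := by
    fun_prop
  have heq : EqOn (derivWithin (derivWithin u (Icc 0 Real.pi)) (Icc 0 Real.pi))
      (fun x => -(α * max (u x) 0 - β * max (-u x) 0)) (Ioo 0 Real.pi) := by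
    intro y hy
    have hmem : Icc 0 Real.pi ∈ nhds y := Icc_mem_nhds hy.1 hy.2
    simp only
    rw [← h.equation y hy, neg_neg, derivWithin_of_mem_nhds hmem]
    refine Filter.EventuallyEq.deriv_eq ?_
    filter_upwards [Ioo_mem_nhds hy.1 hy.2] with z hz
    exact derivWithin_of_mem_nhds (Icc_mem_nhds hz.1 hz.2)
  have hcl : closure (Ioo 0 Real.pi) = Icc 0 Real.pi := closure_Ioo Real.pi_pos.ne
  have heq' := heq.of_subset_closure h2 h3 Ioo_subset_Icc_self hcl.ge
  have h4 := ((h1.differentiableOn (by norm_num)) x hx).hasDerivWithinAt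
  rwa [heq' hx] at h4

theorem abs_max_zero_sub_max_zero_le (x y : ℝ) : |max x 0 - max y 0| ≤ |x - y| := by
  simpa using abs_max_sub_max_le_max x 0 y 0

/-- Uniqueness for the initial value problem of the Fučík equation. -/
theorem IsFucikSolution.eq_of_initial_eq {α β : ℝ} {u : ℝ → ℝ} (h : IsFucikSolution α β u)
    {v v' : ℝ → ℝ} {p q : ℝ} (hp : 0 ≤ p) (hq : q ≤ Real.pi)
    (hv : ∀ x ∈ Icc p q, HasDerivAt v (v' x) x)
    (hv' : ∀ x ∈ Icc p q, HasDerivAt v' (-(α * max (v x) 0 - β * max (-v x) 0)) x)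
    (h0 : u p = v p) (h1 : derivWithin u (Icc 0 Real.pi) p = v' p) {x : ℝ} (hx : x ∈ Icc p q) :
    u x = v x ∧ derivWithin u (Icc 0 Real.pi) x = v' x := by
  have hsub : Icc p q ⊆ Icc 0 Real.pi := Icc_subset_Icc hp hq
  set u' := derivWithin u (Icc 0 Real.pi)
  have hmem {y : ℝ} (hy : y ∈ Ico p q) : Icc 0 Real.pi ∈ nhdsWithin y (Ici y) :=
    Filter.mem_of_superset (Icc_mem_nhdsGE (hy.2.trans_le hq)) (Icc_subset_Icc_left (hp.trans hy.1))
  have hD : ∀ y ∈ Icc p q, ContinuousWithinAt (fun y => (u y - v y, u' y - v' y)) (Icc p q) y := by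
    intro y hy
    exact (((h.hasDerivWithinAt (hsub hy)).continuousWithinAt.mono hsub).sub
      (hv y hy).continuousAt.continuousWithinAt).prodMk
      (((h.hasDerivWithinAt_derivWithin (hsub hy)).continuousWithinAt.mono hsub).sub
      (hv' y hy).continuousAt.continuousWithinAt)
  -- Grönwall for the pair (u − v, u' − v') in the max norm: the first component of the derivative
  -- costs 1, the second the Lipschitz constant |α| + |β| of the nonlinearity.
  have key := eq_zero_of_abs_deriv_le_mul_abs_self_of_eq_zero_right
    (f := fun y => (u y - v y, u' y - v' y))
    (f' := fun y => (u' y - v' y, -(α * max (u y) 0 - β * max (-u y) 0)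
      - -(α * max (v y) 0 - β * max (-v y) 0))) (K := 1 + |α| + |β|) (a := p) (b := q) hD ?_ ?_ ?_
      x hx
  · have h2 := Prod.ext_iff.1 key
    exact ⟨sub_eq_zero.1 h2.1, sub_eq_zero.1 h2.2⟩
  · intro y hy
    have hy' := Ico_subset_Icc_self hy
    have hd1 := (h.hasDerivWithinAt (hsub hy')).mono_of_mem_nhdsWithin (hmem hy)
    have hd2 := (h.hasDerivWithinAt_derivWithin (hsub hy')).mono_of_mem_nhdsWithin (hmem hy)
    exact (hd1.sub (hv y hy').hasDerivWithinAt).prodMk (hd2.sub (hv' y hy').hasDerivWithinAt)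
  · simp [h0, h1, u']
  · intro y _
    have e1 := abs_max_zero_sub_max_zero_le (u y) (v y)
    have e2 := abs_max_zero_sub_max_zero_le (-u y) (-v y)
    have e3 : |-u y - -v y| = |u y - v y| := by rw [← abs_neg]; congr 1; ring
    rw [e3] at e2
    simp only [Prod.norm_def, Real.norm_eq_abs]
    set M := max |u y - v y| |u' y - v' y|
    have hM1 : |u y - v y| ≤ M := le_max_left _ _
    have hM2 : |u' y - v' y| ≤ M := le_max_right _ _
    have hM : 0 ≤ M := (abs_nonneg _).trans hM1
    refine max_le ?_ ?_
    · nlinarith [abs_nonneg α, abs_nonneg β]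
    · calc |-(α * max (u y) 0 - β * max (-u y) 0) - -(α * max (v y) 0 - β * max (-v y) 0)|
          = |β * (max (-u y) 0 - max (-v y) 0) - α * (max (u y) 0 - max (v y) 0)| := by
            congr 1; ring
        _ ≤ |β| * |max (-u y) 0 - max (-v y) 0| + |α| * |max (u y) 0 - max (v y) 0| := by
            rw [← abs_mul, ← abs_mul]; exact abs_sub _ _
        _ ≤ |β| * M + |α| * M := by gcongr <;> linarith
        _ ≤ (1 + |α| + |β|) * M := by linarith

theorem hasDerivAt_const_mul_sin_shift (c a s x : ℝ) :
    HasDerivAt (fun x => c * Real.sin (a * (x - s))) (c * a * Real.cos (a * (x - s))) x := by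
  have h := (((hasDerivAt_id x).sub_const s).const_mul a).sin.const_mul c
  refine h.congr_deriv ?_
  simp; ring

theorem hasDerivAt_const_mul_cos_shift (c a s x : ℝ) :
    HasDerivAt (fun x => c * a * Real.cos (a * (x - s)))
      (-(a ^ 2 * (c * Real.sin (a * (x - s))))) x := by
  have h := (((hasDerivAt_id x).sub_const s).const_mul a).cos.const_mul (c * a)
  refine h.congr_deriv ?_
  simp; ring

/-- A solution that leaves zero upwards at `p` is a positive half-wave up to its next zero. -/
theorem IsFucikSolution.eq_pos_bump {a b : ℝ} {u : ℝ → ℝ} (h : IsFucikSolution (a ^ 2) (b ^ 2) u)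
    (ha : 0 < a) {p d : ℝ} (hd : 0 < d) (hp : 0 ≤ p) (hq : p + Real.pi / a ≤ Real.pi)
    (h0 : u p = 0) (h1 : derivWithin u (Icc 0 Real.pi) p = d) {x : ℝ}
    (hx : x ∈ Icc p (p + Real.pi / a)) :
    u x = d / a * Real.sin (a * (x - p)) ∧
      derivWithin u (Icc 0 Real.pi) x = d * Real.cos (a * (x - p)) := by
  have hda : d / a * a = d := div_mul_cancel₀ d ha.ne'
  have key := h.eq_of_initial_eq hp hq
    (v := fun x => d / a * Real.sin (a * (x - p)))
    (v' := fun x => d / a * a * Real.cos (a * (x - p)))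
    (fun x _ => hasDerivAt_const_mul_sin_shift _ _ _ _) ?_ (by simpa using h0)
    (by simpa [hda] using h1) hx
  · rwa [hda] at key
  · intro y hy
    refine (hasDerivAt_const_mul_cos_shift _ _ _ _).congr_deriv ?_
    have hs : 0 ≤ Real.sin (a * (y - p)) := by
      refine Real.sin_nonneg_of_nonneg_of_le_pi (mul_nonneg ha.le (by linarith [hy.1])) ?_
      rw [← le_div_iff₀' ha]; linarith [hy.2]
    have hv : 0 ≤ d / a * Real.sin (a * (y - p)) := by positivity
    rw [max_eq_left hv, max_eq_right (by linarith)]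
    ring

/-- A solution that leaves zero downwards at `p` is a negative half-wave up to its next zero. -/
theorem IsFucikSolution.eq_neg_bump {a b : ℝ} {u : ℝ → ℝ} (h : IsFucikSolution (a ^ 2) (b ^ 2) u)
    (hb : 0 < b) {p d : ℝ} (hd : 0 < d) (hp : 0 ≤ p) (hq : p + Real.pi / b ≤ Real.pi)
    (h0 : u p = 0) (h1 : derivWithin u (Icc 0 Real.pi) p = -d) {x : ℝ}
    (hx : x ∈ Icc p (p + Real.pi / b)) :
    u x = -(d / b) * Real.sin (b * (x - p)) ∧
      derivWithin u (Icc 0 Real.pi) x = -d * Real.cos (b * (x - p)) := by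
  have hdb : -(d / b) * b = -d := by rw [neg_mul, div_mul_cancel₀ d hb.ne']
  have key := h.eq_of_initial_eq hp hq
    (v := fun x => -(d / b) * Real.sin (b * (x - p)))
    (v' := fun x => -(d / b) * b * Real.cos (b * (x - p)))
    (fun x _ => hasDerivAt_const_mul_sin_shift _ _ _ _) ?_ (by simpa using h0)
    (by simpa [hdb] using h1) hx
  · rwa [hdb] at key
  · intro y hy
    refine (hasDerivAt_const_mul_cos_shift _ _ _ _).congr_deriv ?_
    have hs : 0 ≤ Real.sin (b * (y - p)) := by
      refine Real.sin_nonneg_of_nonneg_of_le_pi (mul_nonneg hb.le (by linarith [hy.1])) ?_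
      rw [← le_div_iff₀' hb]; linarith [hy.2]
    have hv : 0 ≤ d / b * Real.sin (b * (y - p)) := by positivity
    rw [max_eq_right (by linarith), max_eq_left (by linarith)]
    ring

/-- One period of the Fučík eigenfunction with slope `d` at `0`. -/
noncomputable def fucikWave (a b d t : ℝ) : ℝ :=
  if t ≤ Real.pi / a then d / a * Real.sin (a * t)
  else d / b * Real.sin (b * (t - (Real.pi / a + Real.pi / b)))

theorem fucikWave_of_le {a : ℝ} (b d : ℝ) {t : ℝ} (h : t ≤ Real.pi / a) :
    fucikWave a b d t = d / a * Real.sin (a * t) := if_pos h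

/-- Both branches vanish at π/a, so the second formula is also valid at the junction. -/
theorem fucikWave_of_ge {a : ℝ} (ha : 0 < a) (b d : ℝ) {t : ℝ} (h : Real.pi / a ≤ t) :
    fucikWave a b d t = d / b * Real.sin (b * (t - (Real.pi / a + Real.pi / b))) := by
  rcases h.lt_or_eq with h | rfl
  · exact if_neg h.not_ge
  · rw [fucikWave_of_le _ _ le_rfl, mul_div_cancel₀ _ ha.ne', Real.sin_pi]
    rcases eq_or_ne b 0 with rfl | hb
    · simp
    · have : b * (Real.pi / a - (Real.pi / a + Real.pi / b)) = -Real.pi := by field_simp; ring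
      rw [this]; simp

/-- Moves the origin of the negative bump from its left zero, where the ODE supplies it, to the end
of the period. Seen from there it is an arc of (d/b) sin(bs) with s ≤ 0, so both bumps can be
estimated alike. -/
theorem sin_mul_sub_period {a b : ℝ} (hb : 0 < b) (t : ℝ) :
    Real.sin (b * (t - (Real.pi / a + Real.pi / b))) = -Real.sin (b * (t - Real.pi / a)) := by
  have : b * (t - (Real.pi / a + Real.pi / b)) = b * (t - Real.pi / a) - Real.pi := by
    field_simp
    ring
  rw [this, Real.sin_sub_pi]

/-- A solution on `[0, π]` consists of successive copies of one period. -/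
theorem IsFucikSolution.eq_fucikWave {a b : ℝ} {u : ℝ → ℝ} (h : IsFucikSolution (a ^ 2) (b ^ 2) u)
    (ha : 0 < a) (hb : 0 < b) {d : ℝ} (hd : 0 < d)
    (h1 : derivWithin u (Icc 0 Real.pi) 0 = d) {m : ℕ}
    (hm : m * (Real.pi / a + Real.pi / b) = Real.pi) {k : ℕ} (hk : k < m) {t : ℝ}
    (ht : t ∈ Icc 0 (Real.pi / a + Real.pi / b)) :
    u (k * (Real.pi / a + Real.pi / b) + t) = fucikWave a b d t := by
  set P := Real.pi / a + Real.pi / b with hP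
  have hpa : 0 < Real.pi / a := by positivity
  have hpb : 0 < Real.pi / b := by positivity
  have hPpos : 0 < P := by positivity
  have hle (j : ℕ) (hj : j < m) : (j : ℝ) * P + P ≤ Real.pi := by
    rw [← hm, ← add_one_mul]
    gcongr
    exact_mod_cast hj
  -- The data (0, d) at jP become (0, −d) after the positive bump and (0, d) again after the
  -- negative one, which is what lets the induction over periods continue.
  have step (j : ℕ) (hj : j < m) (h0 : u (j * P) = 0)
      (h1 : derivWithin u (Icc 0 Real.pi) (j * P) = d) :
      (∀ x ∈ Icc (j * P) (j * P + Real.pi / a), u x = d / a * Real.sin (a * (x - j * P))) ∧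
      ∀ x ∈ Icc (j * P + Real.pi / a) (j * P + P),
        u x = -(d / b) * Real.sin (b * (x - (j * P + Real.pi / a))) ∧
        derivWithin u (Icc 0 Real.pi) x = -d * Real.cos (b * (x - (j * P + Real.pi / a))) := by
    have hj0 : 0 ≤ (j : ℝ) * P := by positivity
    have hjm := hle j hj
    have A := fun x hx => h.eq_pos_bump ha hd hj0 (by linarith) h0 h1 (x := x) hx
    refine ⟨fun x hx => (A x hx).1, fun x hx => ?_⟩
    have hA := A (j * P + Real.pi / a) ⟨by linarith, le_rfl⟩
    rw [add_sub_cancel_left, mul_div_cancel₀ _ ha.ne', Real.sin_pi, Real.cos_pi] at hA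
    exact h.eq_neg_bump hb hd (by linarith) (by linarith) (by simpa using hA.1)
      (by simpa using hA.2) ⟨hx.1, by linarith [hx.2]⟩
  have start (j : ℕ) (hj : j < m) :
      u (j * P) = 0 ∧ derivWithin u (Icc 0 Real.pi) (j * P) = d := by
    induction j with
    | zero => simpa using ⟨h.left_zero, h1⟩
    | succ j ih =>
      obtain ⟨i0, i1⟩ := ih (by omega)
      have hA := (step j (by omega) i0 i1).2 (j * P + P) ⟨by linarith, le_rfl⟩
      have e : b * (j * P + P - (j * P + Real.pi / a)) = Real.pi := by
        rw [hP]; field_simp; ring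
      rw [e, Real.sin_pi, Real.cos_pi] at hA
      push_cast
      rw [add_one_mul]
      simpa using hA
  obtain ⟨A, B⟩ := step k hk (start k hk).1 (start k hk).2
  rcases le_total t (Real.pi / a) with hta | hta
  · rw [fucikWave_of_le _ _ hta, A _ ⟨by linarith [ht.1], by linarith⟩, add_sub_cancel_left]
  · rw [fucikWave_of_ge ha _ _ hta, (B _ ⟨by linarith, by linarith [ht.2]⟩).1,
      sin_mul_sub_period hb, add_sub_add_left_eq_sub]
    ring

/-- The linear case `α = β = n²`. -/
theorem IsFucikSolution.eq_sin {n : ℝ} {u : ℝ → ℝ} (h : IsFucikSolution (n ^ 2) (n ^ 2) u)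
    (hn : n ≠ 0) {d : ℝ} (h1 : derivWithin u (Icc 0 Real.pi) 0 = d) {x : ℝ}
    (hx : x ∈ Icc 0 Real.pi) : u x = d / n * Real.sin (n * x) := by
  have hda : d / n * n = d := div_mul_cancel₀ d hn
  have key := h.eq_of_initial_eq le_rfl le_rfl
    (v := fun x => d / n * Real.sin (n * (x - 0)))
    (v' := fun x => d / n * n * Real.cos (n * (x - 0)))
    (fun x _ => hasDerivAt_const_mul_sin_shift _ _ _ _) ?_ (by simpa using h.left_zero)
    (by simpa [hda] using h1) hx
  · simpa using key.1
  · intro y _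
    refine (hasDerivAt_const_mul_cos_shift _ _ _ _).congr_deriv ?_
    rw [← mul_sub, max_zero_sub_max_neg_zero_eq_self]

end FucikODE

/-! ### Integrals and estimates for the Fučík wave -/

section FucikWave

open Set

variable {a b d : ℝ}

theorem abs_fucikWave_le (ha : 0 < a) (hb : 0 < b) (hd : 0 < d) (t : ℝ) :
    |fucikWave a b d t| ≤ max (d / a) (d / b) := by
  have key (c : ℝ) (hc : 0 < c) (s : ℝ) : |d / c * Real.sin s| ≤ d / c := by
    rw [abs_mul, abs_of_pos (div_pos hd hc)]
    exact mul_le_of_le_one_right (by positivity) (Real.abs_sin_le_one _)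
  unfold fucikWave
  split_ifs
  · exact (key a ha _).trans (le_max_left _ _)
  · exact (key b hb _).trans (le_max_right _ _)

theorem measurable_fucikWave : Measurable (fucikWave a b d) := by
  unfold fucikWave
  exact Measurable.ite measurableSet_Iic (by fun_prop) (by fun_prop)

theorem intervalIntegrable_fucikWave (ha : 0 < a) (hb : 0 < b) (hd : 0 < d) (s t : ℝ) :
    IntervalIntegrable (fucikWave a b d) volume s t := by
  rw [intervalIntegrable_iff]
  exact Measure.integrableOn_of_bounded (by simp) measurable_fucikWave.aestronglyMeasurable
    (Filter.Eventually.of_forall fun x => abs_fucikWave_le ha hb hd x)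

variable (a b d) in
/-- The periodic extension of `fucikWave a b d`. -/
noncomputable def fucikPeriodic (x : ℝ) : ℝ :=
  fucikWave a b d ((Real.pi / a + Real.pi / b) * Int.fract (x / (Real.pi / a + Real.pi / b)))

theorem fucikPeriodic_add (hP : Real.pi / a + Real.pi / b ≠ 0) :
    Function.Periodic (fucikPeriodic a b d) (Real.pi / a + Real.pi / b) := by
  intro x
  rw [fucikPeriodic, add_div, div_self hP, Int.fract_add_one, fucikPeriodic]

theorem fucikPeriodic_of_mem (hP : 0 < Real.pi / a + Real.pi / b) {t : ℝ}
    (ht : t ∈ Ico 0 (Real.pi / a + Real.pi / b)) : fucikPeriodic a b d t = fucikWave a b d t := by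
  rw [fucikPeriodic, Int.fract_eq_self.2 ⟨div_nonneg ht.1 hP.le, (div_lt_one hP).2 ht.2⟩,
    mul_div_cancel₀ _ hP.ne']

theorem measurable_fucikPeriodic : Measurable (fucikPeriodic a b d) :=
  measurable_fucikWave.comp ((measurable_fract.comp (measurable_id.div_const _)).const_mul _)

theorem abs_fucikPeriodic_le (ha : 0 < a) (hb : 0 < b) (hd : 0 < d) (x : ℝ) :
    |fucikPeriodic a b d x| ≤ max (d / a) (d / b) := abs_fucikWave_le ha hb hd _

theorem intervalIntegrable_fucikPeriodic (ha : 0 < a) (hb : 0 < b) (hd : 0 < d) (s t : ℝ) :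
    IntervalIntegrable (fucikPeriodic a b d) volume s t := by
  rw [intervalIntegrable_iff]
  exact Measure.integrableOn_of_bounded (by simp) measurable_fucikPeriodic.aestronglyMeasurable
    (Filter.Eventually.of_forall fun x => abs_fucikPeriodic_le ha hb hd x)

/-- A function of period `π/m` is orthogonal on `(0, π)` to `sin 2ix` whenever `m` does not
divide `i`. -/
theorem integral_periodic_mul_sin_eq_zero {V : ℝ → ℝ} {m i : ℕ} (hm : m ≠ 0)
    (hV : Function.Periodic V (Real.pi / m)) (hint : IntervalIntegrable V volume 0 Real.pi)
    (hmi : ¬ m ∣ i) : ∫ x in 0..Real.pi, V x * Real.sin ((2 * i : ℕ) * x) = 0 := by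
  have hm' : (m : ℝ) ≠ 0 := by exact_mod_cast hm
  set E : ℝ → ℂ := fun x => Complex.exp ((2 * i * x : ℝ) * Complex.I) with hE
  have hEadd (x y : ℝ) : E (x + y) = E x * E y := by
    simp only [hE, ← Complex.exp_add]
    congr 1
    push_cast
    ring
  have hEpi : E Real.pi = 1 := by
    rw [hE, Complex.exp_eq_one_iff]
    exact ⟨i, by push_cast; ring⟩
  have hEm : E (Real.pi / m) ≠ 1 := by
    rw [hE, Ne, Complex.exp_eq_one_iff]
    rintro ⟨k, hk⟩
    have h1 : (2 * i * (Real.pi / m) : ℝ) = k * (2 * Real.pi) := by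
      have : ((2 * i * (Real.pi / m) : ℝ) : ℂ) * Complex.I = ((k * (2 * Real.pi) : ℝ) : ℂ) * Complex.I := by
        rw [hk]; push_cast; ring
      exact_mod_cast mul_right_cancel₀ Complex.I_ne_zero this
    have h2 : (i : ℝ) = k * m := by
      have := Real.pi_ne_zero
      field_simp at h1
      linarith
    exact hmi (Int.natCast_dvd_natCast.1 ⟨k, by rw [mul_comm]; exact_mod_cast h2⟩)
  have hEc : Continuous E := by fun_prop
  have hVpi : Function.Periodic V Real.pi := by
    have := hV.nat_mul m
    rwa [mul_div_cancel₀ _ hm'] at this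
  have hG : Function.Periodic (fun x => (V x : ℂ) * E x) Real.pi := by
    intro x
    simp only
    rw [hVpi, hEadd, hEpi, mul_one]
  set C : ℂ := ∫ x in 0..Real.pi, (V x : ℂ) * E x with hC
  -- Translation by π/m preserves V and multiplies E by E(π/m), which differs from 1 exactly because
  -- m ∤ i. Hence C = 0, and the sine integral is its imaginary part.
  have hshift : C = E (Real.pi / m) * C := by
    calc C = ∫ x in (0 + Real.pi / m)..(Real.pi + Real.pi / m), (V x : ℂ) * E x := by
          have := hG.intervalIntegral_add_eq 0 (Real.pi / m)
          rw [zero_add] at this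
          rw [hC, this, zero_add, add_comm Real.pi]
      _ = ∫ x in 0..Real.pi, (V (x + Real.pi / m) : ℂ) * E (x + Real.pi / m) :=
          (intervalIntegral.integral_comp_add_right (fun x => (V x : ℂ) * E x) _).symm
      _ = ∫ x in 0..Real.pi, E (Real.pi / m) * ((V x : ℂ) * E x) := by
          congr 1; ext x; rw [hV, hEadd]; ring
      _ = _ := intervalIntegral.integral_const_mul _ _
  have hC0 : C = 0 := by
    have h : (1 - E (Real.pi / m)) * C = 0 := by linear_combination hshift
    exact (mul_eq_zero.1 h).resolve_left (sub_ne_zero.2 hEm.symm)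
  have hi : IntervalIntegrable (fun x => (V x : ℂ) * E x) volume 0 Real.pi :=
    IntervalIntegrable.mul_continuousOn ⟨hint.1.ofReal, hint.2.ofReal⟩ hEc.continuousOn
  have him := Complex.imCLM.intervalIntegral_comp_comm hi
  rw [← hC, hC0, map_zero] at him
  rw [← him]
  congr 1
  ext x
  simp only [hE, Complex.imCLM_apply, Complex.im_ofReal_mul, Complex.exp_ofReal_mul_I_im]
  push_cast
  rfl

/-- A half-wave `sin ax` correlates positively with `sin nx` on its bump, whenever `n < 2a`. -/
theorem integral_sin_bump_mul_sin_pos {n : ℝ} (ha : 0 < a) (hn : 0 < n) (hna : n < 2 * a) :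
    0 < ∫ t in 0..Real.pi / a, Real.sin (a * t) * Real.sin (n * t) := by
  have hpi := Real.pi_pos
  rcases eq_or_ne a n with rfl | hne
  · rw [integral_sin_mul_sq ha.ne', mul_div_cancel₀ _ ha.ne', Real.sin_pi]
    simp only [zero_mul, zero_div, sub_zero]
    positivity
  · have hsq : a ^ 2 ≠ n ^ 2 := fun h => hne ((sq_eq_sq₀ ha.le hn.le).1 h)
    rw [integral_sin_mul_mul_sin_mul hsq, mul_div_cancel₀ _ ha.ne', Real.sin_pi, Real.cos_pi]
    have e : (a * -1 * Real.sin (n * (Real.pi / a)) - n * 0 * Real.cos (n * (Real.pi / a))) /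
        (n ^ 2 - a ^ 2) = a * Real.sin (n * (Real.pi / a)) / (a ^ 2 - n ^ 2) := by
      rw [← neg_sub (a ^ 2), div_neg, ← neg_div]; ring_nf
    rw [e]
    have h2 : n * (Real.pi / a) < 2 * Real.pi := by
      rw [← mul_div_assoc, div_lt_iff₀ ha]; nlinarith
    -- Since 0 < nπ/a < 2π, the sign of sin(nπ/a) is that of a − n, matching the denominator.
    rcases hne.lt_or_gt with h | h
    · refine div_pos_of_neg_of_neg (mul_neg_of_pos_of_neg ha ?_) (by nlinarith)
      have h3 : Real.pi < n * (Real.pi / a) := by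
        rw [← mul_div_assoc, lt_div_iff₀ ha]; nlinarith
      have := Real.sin_pos_of_pos_of_lt_pi (x := n * (Real.pi / a) - Real.pi)
        (by linarith) (by linarith)
      rw [Real.sin_sub_pi] at this
      linarith
    · refine div_pos (mul_pos ha (Real.sin_pos_of_pos_of_lt_pi (by positivity) ?_)) (by nlinarith)
      rw [← mul_div_assoc, div_lt_iff₀ ha]; nlinarith

/-- The relation n/a + n/b = 2 yields n < 2a, n < 2b and a common period P with nP = 2π. The
reflection t ↦ P − t changes the sign of sin nt and turns the negative bump into sin bt, so both
bumps reduce to the same positive integral. -/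
theorem integral_fucikWave_mul_sin_pos {n : ℝ} (ha : 0 < a) (hb : 0 < b) (hd : 0 < d)
    (hn : 0 < n) (hab : n / a + n / b = 2) :
    0 < ∫ t in 0..Real.pi / a + Real.pi / b, fucikWave a b d t * Real.sin (n * t) := by
  have hpa : 0 < Real.pi / a := by positivity
  have hpb : 0 < Real.pi / b := by positivity
  have hna : n < 2 * a := by
    rw [← div_lt_iff₀ ha]; have : 0 < n / b := by positivity
    linarith
  have hnb : n < 2 * b := by
    rw [← div_lt_iff₀ hb]; have : 0 < n / a := by positivity
    linarith
  have hper : n * (Real.pi / a + Real.pi / b) = 2 * Real.pi := by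
    rw [← hab]; ring
  have h1 : EqOn (fun t => d / a * (Real.sin (a * t) * Real.sin (n * t)))
      (fun t => fucikWave a b d t * Real.sin (n * t)) (uIcc 0 (Real.pi / a)) := by
    intro t ht
    rw [uIcc_of_le hpa.le] at ht
    simp only
    rw [fucikWave_of_le _ _ ht.2, mul_assoc]
  have h2 : EqOn (fun t => d / b * (Real.sin (b * (Real.pi / a + Real.pi / b - t)) *
        Real.sin (n * (Real.pi / a + Real.pi / b - t))))
      (fun t => fucikWave a b d t * Real.sin (n * t))
      (uIcc (Real.pi / a) (Real.pi / a + Real.pi / b)) := by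
    intro t ht
    rw [uIcc_of_le (by linarith)] at ht
    simp only
    rw [fucikWave_of_ge ha _ _ ht.1, mul_sub n, hper, Real.sin_two_pi_sub, ← neg_sub t, mul_neg b,
      Real.sin_neg (b * _)]
    ring
  have hi (s t : ℝ) : IntervalIntegrable (fun t => fucikWave a b d t * Real.sin (n * t)) volume s t :=
    (intervalIntegrable_fucikWave ha hb hd s t).mul_continuousOn (by fun_prop)
  rw [← intervalIntegral.integral_add_adjacent_intervals (hi 0 (Real.pi / a)) (hi _ _),
    ← intervalIntegral.integral_congr h1, ← intervalIntegral.integral_congr h2,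
    intervalIntegral.integral_const_mul, intervalIntegral.integral_const_mul,
    intervalIntegral.integral_comp_sub_left
      (fun t => Real.sin (b * t) * Real.sin (n * t)), sub_self, add_sub_cancel_left]
  have := integral_sin_bump_mul_sin_pos ha hn hna
  have := integral_sin_bump_mul_sin_pos hb hn hnb
  positivity

theorem integral_fucikPeriodic_mul_sin_pos {m : ℕ} (hm : m ≠ 0) (ha : 0 < a) (hb : 0 < b)
    (hd : 0 < d) (hab : m * (Real.pi / a + Real.pi / b) = Real.pi) :
    0 < ∫ t in 0..Real.pi, fucikPeriodic a b d t * Real.sin ((2 * m : ℕ) * t) := by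
  have hpi := Real.pi_pos
  have hP : 0 < Real.pi / a + Real.pi / b := by positivity
  have hm' : 0 < (m : ℝ) := by exact_mod_cast Nat.pos_of_ne_zero hm
  have hper : Function.Periodic (fun t => fucikPeriodic a b d t * Real.sin ((2 * m : ℕ) * t))
      (Real.pi / a + Real.pi / b) := by
    intro t
    simp only
    rw [fucikPeriodic_add hP.ne']
    congr 1
    have : ((2 * m : ℕ) : ℝ) * (t + (Real.pi / a + Real.pi / b)) = (2 * m : ℕ) * t + 2 * Real.pi := by
      push_cast; linear_combination 2 * hab
    rw [this, Real.sin_add_two_pi]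
  have h := hper.intervalIntegral_add_zsmul_eq m 0 fun s t =>
    (intervalIntegrable_fucikPeriodic ha hb hd s t).mul_continuousOn (by fun_prop)
  simp only [zero_add, zsmul_eq_mul, Int.cast_natCast, hab] at h
  rw [h]
  refine mul_pos hm' ?_
  have hcongr : ∫ t in 0..Real.pi / a + Real.pi / b,
      fucikPeriodic a b d t * Real.sin ((2 * m : ℕ) * t) =
      ∫ t in 0..Real.pi / a + Real.pi / b, fucikWave a b d t * Real.sin ((2 * m : ℕ) * t) := by
    refine intervalIntegral.integral_congr_Ioo_of_le hP.le fun t ht => ?_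
    rw [fucikPeriodic_of_mem hP (Ioo_subset_Ico_self ht)]
  rw [hcongr]
  refine integral_fucikWave_mul_sin_pos ha hb hd (by positivity) ?_
  have h2 : Real.pi * ((2 * m : ℕ) / a + (2 * m : ℕ) / b) = Real.pi * 2 := by
    push_cast; linear_combination 2 * hab
  exact mul_left_cancel₀ hpi.ne' h2

/-- Everything is a function of q = n/b ≤ 1, as n/a = 2 − q; the bounds reduce to 1 − q ≤ 1/q − 1.
The third quantity is the amplitude defect of the lower bump. -/
theorem abs_one_sub_div_le {n : ℝ} (ha : 0 < a) (hb : 0 < b) (hn : 0 < n)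
    (hab : n / a + n / b = 2) (hle : a ≤ b) :
    |1 - n / a| ≤ b / n - 1 ∧ |1 - n / b| ≤ b / n - 1 ∧ |a / b - 1| ≤ 2 * (b / n - 1) := by
  set q := n / b with hq
  have hq0 : 0 < q := by positivity
  have hpa : n / a = 2 - q := by linarith
  have hp0 : 0 < n / a := by positivity
  have hqp : q ≤ n / a := div_le_div_of_nonneg_left hn.le ha hle
  have hq1 : q ≤ 1 := by linarith
  have hbn : b / n = 1 / q := by rw [hq, one_div_div]
  have hab' : a / b = q / (2 - q) := by rw [← hpa, hq]; field_simp
  have hqq : 1 - q ≤ 1 / q - 1 := by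
    rw [le_sub_iff_add_le, le_div_iff₀ hq0]; nlinarith [sq_nonneg (1 - q)]
  rw [hpa, hbn, hab']
  refine ⟨?_, ?_, ?_⟩
  · rw [abs_le]; constructor <;> linarith
  · rw [abs_le]; constructor <;> linarith
  · have h1 : q / (2 - q) ≤ 1 := by rw [div_le_one] <;> linarith
    have h2 : 1 - 2 * (1 - q) ≤ q / (2 - q) := by
      rw [le_div_iff₀ (by linarith)]; nlinarith [sq_nonneg (1 - q)]
    rw [abs_le]; constructor <;> linarith

/-- The distance between the Fučík wave and the sine of the same period. -/
theorem abs_fucikWave_sub_sin_le {n : ℝ} (ha : 0 < a) (hb : 0 < b) (hd : 0 < d)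
    (hn : 0 < n) (hab : n / a + n / b = 2) (hmax : max (d / a) (d / b) = 1) {t : ℝ}
    (ht : t ∈ Icc 0 (Real.pi / a + Real.pi / b)) :
    |fucikWave a b d t - Real.sin (n * t)| ≤ (2 + Real.pi) * (max a b / n - 1) := by
  have hpi := Real.pi_pos
  have hper : n * (Real.pi / a + Real.pi / b) = 2 * Real.pi := by
    rw [← hab]; ring
  -- The normalization forces d = min(a, b), so one amplitude is exactly 1 and the other is min/max.
  have hδ : ∀ c, (c = a ∨ c = b) → |1 - n / c| ≤ max a b / n - 1 ∧
      |d / c - 1| ≤ 2 * (max a b / n - 1) := by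
    rcases le_total a b with h | h
    · rw [max_eq_left (by gcongr), div_eq_one_iff_eq ha.ne'] at hmax
      rw [max_eq_right h, hmax]
      obtain ⟨h1, h2, h3⟩ := abs_one_sub_div_le ha hb hn hab h
      have h0 := (abs_nonneg _).trans h1
      rintro c (rfl | rfl)
      · exact ⟨h1, by rw [div_self ha.ne']; simpa using h0⟩
      · exact ⟨h2, h3⟩
    · rw [max_eq_right (by gcongr), div_eq_one_iff_eq hb.ne'] at hmax
      rw [max_eq_left h, hmax]
      obtain ⟨h1, h2, h3⟩ := abs_one_sub_div_le hb ha hn (by rwa [add_comm]) h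
      have h0 := (abs_nonneg _).trans h1
      rintro c (rfl | rfl)
      · exact ⟨h2, h3⟩
      · exact ⟨h1, by rw [div_self hb.ne']; simpa using h0⟩
  -- The 2 comes from the amplitude defect, the π from the frequency mismatch |c − n||s| with |s| ≤
  -- π/c.
  have key : ∀ c, 0 < c → (c = a ∨ c = b) → ∀ s, |s| ≤ Real.pi / c →
      |d / c * Real.sin (c * s) - Real.sin (n * s)| ≤ (2 + Real.pi) * (max a b / n - 1) := by
    intro c hc hcab s hs
    obtain ⟨h1, h2⟩ := hδ c hcab
    have e1 : |(d / c - 1) * Real.sin (c * s)| ≤ |d / c - 1| := by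
      rw [abs_mul]
      exact mul_le_of_le_one_right (abs_nonneg _) (Real.abs_sin_le_one _)
    have e2 : |Real.sin (c * s) - Real.sin (n * s)| ≤ Real.pi * |1 - n / c| := by
      calc |Real.sin (c * s) - Real.sin (n * s)| ≤ |c * s - n * s| := by
            simpa [Real.dist_eq] using Real.lipschitzWith_sin.dist_le_mul (c * s) (n * s)
        _ = c * |s| * |1 - n / c| := by
            rw [← abs_of_pos hc, ← abs_mul, ← abs_mul, abs_of_pos hc]
            congr 1
            field_simp
        _ ≤ c * (Real.pi / c) * |1 - n / c| := by gcongr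
        _ = _ := by rw [mul_div_cancel₀ _ hc.ne']
    calc |d / c * Real.sin (c * s) - Real.sin (n * s)|
        = |(d / c - 1) * Real.sin (c * s) + (Real.sin (c * s) - Real.sin (n * s))| := by
          congr 1; ring
      _ ≤ |d / c - 1| + Real.pi * |1 - n / c| := (abs_add_le _ _).trans (add_le_add e1 e2)
      _ ≤ 2 * (max a b / n - 1) + Real.pi * (max a b / n - 1) := by gcongr
      _ = _ := by ring
  rcases le_total t (Real.pi / a) with hta | hta
  · rw [fucikWave_of_le _ _ hta]
    exact key a ha (Or.inl rfl) t (by rwa [abs_of_nonneg ht.1])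
  · rw [fucikWave_of_ge ha _ _ hta]
    have : Real.sin (n * t) = Real.sin (n * (t - (Real.pi / a + Real.pi / b))) := by
      rw [mul_sub, hper, Real.sin_sub_two_pi]
    rw [this]
    refine key b hb (Or.inr rfl) _ ?_
    rw [abs_of_nonpos (by linarith [ht.2])]
    linarith

end FucikWave

/-! ### Normalized eigenfunctions and their sine coefficients -/

section FucikSystem

open Set

theorem IsNormalizedFucikEigenfunction.eq_sin {n : ℕ} (hn : n ≠ 0) {u : ℝ → ℝ}
    (h : IsNormalizedFucikEigenfunction n ((n : ℝ) ^ 2) ((n : ℝ) ^ 2) u) {x : ℝ}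
    (hx : x ∈ Icc 0 Real.pi) : u x = Real.sin (n * x) := by
  rcases h with ⟨rfl, -, h⟩ | ⟨h2, -, hsol, hd, hlub⟩
  · simpa using h x hx
  · have hn' : (0 : ℝ) < n := by exact_mod_cast Nat.pos_of_ne_zero hn
    have hpi := Real.pi_pos
    set d := derivWithin u (Icc 0 Real.pi) 0
    have hu {y : ℝ} (hy : y ∈ Icc 0 Real.pi) : u y = d / n * Real.sin (n * y) :=
      hsol.eq_sin hn'.ne' rfl hy
    have hdn : 0 < d / n := by positivity
    have hn2 : (2 : ℝ) ≤ n := by exact_mod_cast h2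
    have h1 : d / n ≤ 1 := by
      -- The first crest, where the amplitude d/n is attained.
      have hmem : Real.pi / 2 / n ∈ Icc 0 Real.pi :=
        ⟨by positivity, by rw [div_le_iff₀ hn']; nlinarith⟩
      have := hlub.1 (mem_image_of_mem (fun y => |u y|) hmem)
      rwa [hu hmem, mul_div_cancel₀ _ hn'.ne', Real.sin_pi_div_two, mul_one,
        abs_of_pos hdn] at this
    have h3 : 1 ≤ d / n := by
      refine hlub.2 ?_
      rintro _ ⟨y, hy, rfl⟩
      simp only
      rw [hu hy, abs_mul, abs_of_pos hdn]
      exact mul_le_of_le_one_right hdn.le (Real.abs_sin_le_one _)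
    rw [hu hx, le_antisymm h1 h3, one_mul]

/-- For even index a whole number m of periods fills [0, π], which is what makes the periodic
extension available. The right endpoint is excluded so that ⌊x/P⌋ < m. -/
theorem IsNormalizedFucikEigenfunction.eq_fucikPeriodic {m : ℕ} (hm : m ≠ 0) {α β : ℝ}
    {u : ℝ → ℝ} (h : IsNormalizedFucikEigenfunction (2 * m) α β u) :
    0 < √α ∧ 0 < √β ∧ m * (Real.pi / √α + Real.pi / √β) = Real.pi ∧
      ∃ d, 0 < d ∧ max (d / √α) (d / √β) = 1 ∧
        ∀ x ∈ Ico 0 Real.pi, u x = fucikPeriodic √α √β d x := by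
  rcases h with ⟨h1, -⟩ | ⟨-, hcurve, hsol, hd, hlub⟩
  · omega
  obtain ⟨hα, hβ, hper⟩ := hcurve
  simp only at hα hβ hper
  rw [if_pos (even_two_mul m)] at hper
  have hper' : m * (Real.pi / √α + Real.pi / √β) = Real.pi := by
    push_cast at hper; linear_combination hper
  rw [← Real.sq_sqrt hα.le, ← Real.sq_sqrt hβ.le] at hsol
  have ha := Real.sqrt_pos.2 hα
  have hb := Real.sqrt_pos.2 hβ
  refine ⟨ha, hb, hper', ?_⟩
  generalize √α = a at *
  generalize √β = b at *
  set d := derivWithin u (Icc 0 Real.pi) 0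
  have hpi := Real.pi_pos
  have hpa : 0 < Real.pi / a := by positivity
  have hpb : 0 < Real.pi / b := by positivity
  have hm' : (0 : ℝ) < m := by exact_mod_cast Nat.pos_of_ne_zero hm
  set P := Real.pi / a + Real.pi / b with hP
  have hPpos : 0 < P := by positivity
  have hwave {k : ℕ} (hk : k < m) {t : ℝ} (ht : t ∈ Icc 0 P) :
      u (k * P + t) = fucikWave a b d t := hsol.eq_fucikWave ha hb hd rfl hper' hk ht
  have hu : ∀ x ∈ Ico 0 Real.pi, u x = fucikPeriodic a b d x := by
    intro x hx
    have hxP : 0 ≤ x / P := div_nonneg hx.1 hPpos.le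
    have hk : ⌊x / P⌋₊ < m := by
      rw [Nat.floor_lt hxP, div_lt_iff₀ hPpos, hper']; exact hx.2
    have hfr : (⌊x / P⌋₊ : ℝ) + Int.fract (x / P) = x / P := by
      rw [natCast_floor_eq_intCast_floor hxP, Int.floor_add_fract]
    have hx' : x = ⌊x / P⌋₊ * P + P * Int.fract (x / P) := by
      have : P * (x / P) = x := mul_div_cancel₀ _ hPpos.ne'
      linear_combination (-1 : ℝ) * this - P * hfr
    have ht : P * Int.fract (x / P) ∈ Icc 0 P :=
      ⟨mul_nonneg hPpos.le (Int.fract_nonneg _),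
        mul_le_of_le_one_right hPpos.le (Int.fract_lt_one _).le⟩
    conv_lhs => rw [hx']
    exact hwave hk ht
  have hPle : P ≤ Real.pi := by
    have : (1 : ℝ) ≤ m := by exact_mod_cast Nat.pos_of_ne_zero hm
    nlinarith
  have hle {t : ℝ} (ht : t ∈ Icc 0 P) : |fucikWave a b d t| ≤ 1 := by
    have := hwave (Nat.pos_of_ne_zero hm) ht
    simp only [Nat.cast_zero, zero_mul, zero_add] at this
    rw [← this]
    exact hlub.1 (mem_image_of_mem (fun x => |u x|) ⟨ht.1, ht.2.trans hPle⟩)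
  refine ⟨d, hd, le_antisymm (max_le ?_ ?_) (hlub.2 ?_), hu⟩
  -- The amplitudes d/a and d/b are attained at the midpoints of the two bumps.
  · have := hle (t := Real.pi / a / 2) ⟨by positivity, by linarith⟩
    rw [fucikWave_of_le _ _ (by linarith),
      show a * (Real.pi / a / 2) = Real.pi / 2 by field_simp, Real.sin_pi_div_two, mul_one,
      abs_of_pos (by positivity)] at this
    exact this
  · have := hle (t := Real.pi / a + Real.pi / b / 2) ⟨by positivity, by linarith⟩
    rw [fucikWave_of_ge ha _ _ (by linarith),
      show b * (Real.pi / a + Real.pi / b / 2 - (Real.pi / a + Real.pi / b)) = -(Real.pi / 2) by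
        field_simp; ring, Real.sin_neg, Real.sin_pi_div_two, mul_neg, mul_one, abs_neg,
      abs_of_pos (by positivity)] at this
    exact this
  · rintro _ ⟨x, hx, rfl⟩
    simp only
    rcases hx.2.lt_or_eq with hlt | rfl
    · rw [hu x ⟨hx.1, hlt⟩]
      exact abs_fucikPeriodic_le ha hb hd x
    · rw [hsol.right_zero, abs_zero]
      positivity

theorem IsNormalizedFucikEigenfunction.continuousOn {n : ℕ} {α β : ℝ} {u : ℝ → ℝ}
    (h : IsNormalizedFucikEigenfunction n α β u) : ContinuousOn u (Icc 0 Real.pi) := by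
  rcases h with ⟨-, -, h⟩ | ⟨-, -, h, -⟩
  · exact Real.continuous_sin.continuousOn.congr h
  · exact h.contDiffOn.continuousOn

theorem ContinuousOn.memLp_Ioo_zero_pi {u : ℝ → ℝ} (h : ContinuousOn u (Icc 0 Real.pi)) :
    MemLp u 2 (volume.restrict (Ioo 0 Real.pi)) := by
  obtain ⟨C, hC⟩ := isCompact_Icc.exists_bound_of_continuousOn h
  refine MemLp.of_bound ((h.mono Ioo_subset_Icc_self).aestronglyMeasurable measurableSet_Ioo) C ?_
  filter_upwards [ae_restrict_mem measurableSet_Ioo] with x hx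
  exact hC x (Ioo_subset_Icc_self hx)

section EvenIndex

variable {m : ℕ} {α β : ℝ} {u : ℝ → ℝ}

theorem IsNormalizedFucikEigenfunction.integral_sin_mul_eq (hm : m ≠ 0)
    (h : IsNormalizedFucikEigenfunction (2 * m) α β u) :
    ∃ d, 0 < d ∧ ∀ c : ℝ, ∫ x in 0..Real.pi, Real.sin (c * x) * u x =
      ∫ x in 0..Real.pi, fucikPeriodic √α √β d x * Real.sin (c * x) := by
  obtain ⟨-, -, -, d, hd, -, hu⟩ := h.eq_fucikPeriodic hm
  refine ⟨d, hd, fun c => intervalIntegral.integral_congr_Ioo_of_le Real.pi_pos.le fun x hx => ?_⟩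
  rw [hu x (Ioo_subset_Ico_self hx), mul_comm]

theorem IsNormalizedFucikEigenfunction.integral_sin_mul_pos (hm : m ≠ 0)
    (h : IsNormalizedFucikEigenfunction (2 * m) α β u) :
    0 < ∫ x in 0..Real.pi, Real.sin ((2 * m : ℕ) * x) * u x := by
  obtain ⟨ha, hb, hper, -⟩ := h.eq_fucikPeriodic hm
  obtain ⟨d, hd, hint⟩ := h.integral_sin_mul_eq hm
  rw [hint]
  exact integral_fucikPeriodic_mul_sin_pos hm ha hb hd hper

theorem IsNormalizedFucikEigenfunction.integral_sin_mul_eq_zero (hm : m ≠ 0)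
    (h : IsNormalizedFucikEigenfunction (2 * m) α β u) {i : ℕ} (hi : ¬ m ∣ i) :
    ∫ x in 0..Real.pi, Real.sin ((2 * i : ℕ) * x) * u x = 0 := by
  obtain ⟨ha, hb, hper, -⟩ := h.eq_fucikPeriodic hm
  obtain ⟨d, hd, hint⟩ := h.integral_sin_mul_eq hm
  have hpi := Real.pi_pos
  have hm' : (m : ℝ) ≠ 0 := by exact_mod_cast hm
  have hP : Real.pi / m = Real.pi / √α + Real.pi / √β := by
    rw [div_eq_iff hm', mul_comm, hper]
  rw [hint]
  refine integral_periodic_mul_sin_eq_zero hm ?_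
    (intervalIntegrable_fucikPeriodic ha hb hd _ _) hi
  rw [hP]
  exact fucikPeriodic_add (by positivity)

theorem IsNormalizedFucikEigenfunction.abs_sub_sin_le (hm : m ≠ 0)
    (h : IsNormalizedFucikEigenfunction (2 * m) α β u) {x : ℝ} (hx : x ∈ Ico 0 Real.pi) :
    |u x - Real.sin ((2 * m : ℕ) * x)| ≤
      (2 + Real.pi) * (max √α √β / (2 * m : ℕ) - 1) := by
  obtain ⟨ha, hb, hper, d, hd, hmax, hu⟩ := h.eq_fucikPeriodic hm
  have hpi := Real.pi_pos
  set P := Real.pi / √α + Real.pi / √β with hP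
  have hPpos : 0 < P := by positivity
  have hm' : (0 : ℝ) < m := by exact_mod_cast Nat.pos_of_ne_zero hm
  have h2 : ((2 * m : ℕ) : ℝ) / √α + (2 * m : ℕ) / √β = 2 := by
    refine mul_left_cancel₀ hpi.ne' ?_
    push_cast
    linear_combination 2 * hper
  -- As 2mP = 2π, the sine has period P as well, so the comparison reduces to one period.
  have hsin : Real.sin ((2 * m : ℕ) * x) = Real.sin ((2 * m : ℕ) * (P * Int.fract (x / P))) := by
    have h3 : x = P * Int.fract (x / P) + ⌊x / P⌋ * P := by
      have h4 : P * (x / P) = x := mul_div_cancel₀ _ hPpos.ne'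
      linear_combination (-1 : ℝ) * h4 - P * Int.floor_add_fract (x / P)
    have h5 : ((2 * m : ℕ) : ℝ) * x =
        (2 * m : ℕ) * (P * Int.fract (x / P)) + ⌊x / P⌋ * (2 * Real.pi) := by
      push_cast
      linear_combination 2 * (m : ℝ) * h3 + 2 * (⌊x / P⌋ : ℝ) * hper
    rw [h5, Real.sin_add_int_mul_two_pi]
  rw [hu x hx, hsin]
  exact abs_fucikWave_sub_sin_le ha hb hd (by positivity) h2 hmax
    ⟨mul_nonneg hPpos.le (Int.fract_nonneg _),
      mul_le_of_le_one_right hPpos.le (Int.fract_lt_one _).le⟩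

end EvenIndex

theorem toL2_const_mul {𝕜 : Type*} [RCLike 𝕜] (c : ℝ) {f : ℝ → ℝ}
    (hf : MemLp f 2 (volume.restrict (Ioo 0 Real.pi)))
    (hcf : MemLp (fun x => c * f x) 2 (volume.restrict (Ioo 0 Real.pi))) :
    toL2 𝕜 hcf = (c : 𝕜) • toL2 𝕜 hf := by
  rw [toL2, toL2, ← MemLp.toLp_const_smul]
  congr 1
  ext x
  simp

end FucikSystem

/-! ### Assembly of the Riesz basis -/

theorem theorem2 (𝕜 : Type*) [RCLike 𝕜] (α β : ℕ → ℝ) (F : ℕ → ℝ → ℝ)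
    (hF : IsFucikSystem α β F)
    (hodd : ∀ n : ℕ, Odd n → α n = (n : ℝ) ^ 2 ∧ β n = (n : ℝ) ^ 2)
    (hsum : Summable fun n : ℕ =>
      (max √(α (n + 2)) √(β (n + 2)) / ((n + 2 : ℕ) : ℝ) - 1) ^ 2) :
    IsRieszBasisL2 𝕜 F := by
  have hpi := Real.pi_pos
  have heig (k : ℕ) := hF.eigenfunction (k + 1) (Nat.le_add_left 1 k)
  have hL (k : ℕ) : MemLp (F (k + 1)) 2 (volume.restrict (Set.Ioo 0 Real.pi)) :=
    (heig k).continuousOn.memLp_Ioo_zero_pi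
  have hsin (k : ℕ) (hk : Odd (k + 1)) {x : ℝ} (hx : x ∈ Set.Icc 0 Real.pi) :
      F (k + 1) x = Real.sin ((k + 1 : ℕ) * x) := by
    have h := heig k
    rw [(hodd _ hk).1, (hodd _ hk).2] at h
    exact h.eq_sin k.succ_ne_zero hx
  have hS (k : ℕ) : MemLp (fun x => Real.sin ((k + 1 : ℕ) * x)) 2
      (volume.restrict (Set.Ioo 0 Real.pi)) := by
    simpa using memLp_smul_sin 1 (k + 1)
  set c : ℝ := √(2 / Real.pi) with hc
  have hc0 : (c : 𝕜) ≠ 0 := by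
    have : c ≠ 0 := by positivity
    exact_mod_cast this
  have hbasis (k : ℕ) : sineBasis 𝕜 k = (c : 𝕜) • toL2 𝕜 (hS k) := by
    rw [sineBasis_apply, toL2_const_mul]
  have hinner (k l : ℕ) : inner 𝕜 (sineBasis 𝕜 k) ((c : 𝕜) • toL2 𝕜 (hL l)) =
      (c : 𝕜) * ((c : 𝕜) *
        ((∫ x in 0..Real.pi, Real.sin ((k + 1 : ℕ) * x) * F (l + 1) x : ℝ) : 𝕜)) := by
    rw [hbasis, inner_smul_left, inner_smul_right, inner_toL2_toL2, RCLike.conj_ofReal]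
  have hodd_int (k l : ℕ) (hl : Odd (l + 1)) :
      ∫ x in 0..Real.pi, Real.sin ((k + 1 : ℕ) * x) * F (l + 1) x =
        if k + 1 = l + 1 then Real.pi / 2 else 0 := by
    rw [← integral_sin_nat_mul_sin_nat l.succ_ne_zero]
    refine intervalIntegral.integral_congr_Ioo_of_le hpi.le fun x hx => ?_
    rw [hsin l hl (Set.Ioo_subset_Icc_self hx)]
  refine ⟨fun k => (hL k).ofReal, ?_⟩
  change IsRieszBasis 𝕜 fun k => toL2 𝕜 (hL k)
  refine IsRieszBasis.of_smul hc0 ((sineBasis 𝕜).isRieszBasis_of_triangular ?_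
    -- Position k carries the function of index k + 1. The lexicographic rank puts even indices
    -- before odd ones, each class in its natural order.
    (fun k => toLex ((k + 1) % 2, k)) ?_ ?_)
  -- The hypothesis starts at n = 2, so the term n = 1 is dropped. The constant is (2/π) · π · (2 +
  -- π)².
  · refine (summable_nat_add_iff 1).1 (Summable.of_nonneg_of_le (fun _ => sq_nonneg _)
      (fun k => ?_) (hsum.mul_left (2 * (2 + Real.pi) ^ 2)))
    set δ := max √(α (k + 2)) √(β (k + 2)) / ((k + 2 : ℕ) : ℝ) - 1 with hδ
    -- Using |δ| avoids having to know that δ ≥ 0.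
    have hb : ‖toL2 𝕜 (hL (k + 1)) - toL2 𝕜 (hS (k + 1))‖ ^ 2 ≤
        Real.pi * ((2 + Real.pi) * |δ|) ^ 2 := by
      refine norm_toL2_sub_toL2_sq_le _ _ (by positivity) fun x hx => ?_
      rcases Nat.even_or_odd' (k + 1 + 1) with ⟨m, hm | hm⟩
      · have h := heig (k + 1)
        rw [hm] at h
        have h2 := h.abs_sub_sin_le (by omega) (Set.Ioo_subset_Ico_self hx)
        rw [← hm] at h2
        exact h2.trans (by gcongr; exact le_abs_self _)
      · rw [hsin (k + 1) ⟨m, hm⟩ (Set.Ioo_subset_Icc_self hx), sub_self, abs_zero]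
        positivity
    rw [hbasis, ← smul_sub, norm_smul, mul_pow, RCLike.norm_ofReal, sq_abs, hc,
      Real.sq_sqrt (by positivity)]
    calc 2 / Real.pi * ‖toL2 𝕜 (hL (k + 1)) - toL2 𝕜 (hS (k + 1))‖ ^ 2
        ≤ 2 / Real.pi * (Real.pi * ((2 + Real.pi) * |δ|) ^ 2) := by gcongr
      _ = 2 * (2 + Real.pi) ^ 2 * δ ^ 2 := by
        rw [mul_pow, sq_abs]; field_simp
  · intro k
    rw [hinner]
    refine mul_ne_zero hc0 (mul_ne_zero hc0 (RCLike.ofReal_ne_zero.2 ?_))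
    rcases Nat.even_or_odd' (k + 1) with ⟨m, hm | hm⟩
    · have h := heig k
      rw [hm] at h ⊢
      exact (h.integral_sin_mul_pos (by omega)).ne'
    · rw [hodd_int k k ⟨m, hm⟩, if_pos rfl]
      positivity
  · intro k l hlk hrank
    rw [hinner]
    suffices h : ∫ x in 0..Real.pi, Real.sin ((k + 1 : ℕ) * x) * F (l + 1) x = 0 by
      rw [h]; simp
    rw [Prod.Lex.toLex_lt_toLex] at hrank
    rcases Nat.even_or_odd' (l + 1) with ⟨m, hm | hm⟩
    -- An even index that does not rank below k + 1 forces k + 1 = 2i to be even as well, with 0 < i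
    -- < m, so m ∤ i.
    · obtain ⟨i, hi⟩ : ∃ i, k + 1 = 2 * i := ⟨(k + 1) / 2, by omega⟩
      have h := heig l
      rw [hm] at h
      rw [hi, hm]
      refine h.integral_sin_mul_eq_zero (by omega) fun hdvd => ?_
      have := Nat.le_of_dvd (by omega) hdvd
      omega
    · rw [hodd_int k l ⟨m, hm⟩, if_neg (by omega)]
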